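/- **Setting.** Let $D\ge 1$ and let $d:X\times X\to[0,\infty)$ be a $D$-distance on a set $X$: $d(u,u)=0$, $d(u,v)=d(v,u)$ and $d(u,v)\le D\,(d(u,w)+d(w,v))$ for all $u,v,w\in X$ (for instance $d(u,v)=\|u-v\|^2$ with $D=2$, the $k$-means cost). For data points $x_1,\dots,x_n\in X$ (repetitions allowed) and centers $c_1,\dots,c_m\in X$ put $cost(c_1,\dots,c_m)=\sum_{i=1}^n\min_j d(x_i,c_j)$, and let $opt_k$ be the infimum of the cost over all choices of $k$ centers in $X$. Farthest-first-traversal of a finite set $M$ of data points from $s\in M$ starts with $S=\{s\}$ and then $k-1$ times adds to $S$ a point of $M\setminus S$ that maximizes $\min_{y\in S}d(\cdot,y)$ (it stops if $S=M$); ties are broken by an arbitrary fixed rule which depends only on the set of tied data points, not on the order of arrival. Equal data points with different indices count as different data points. **Algorithm** (parameter $k\ge1$; $n$ is not known). The first $k$ arriving points are taken as centers. A point that arrives later is taken as a center if and only if it belongs to the farthest-first-traversal with $k$ points, started at the first point that arrived, of the set of all points that have arrived so far, including itself. **Theorem.** There are an absolute constant $C>0$, constants $B_k$ depending only on $k$,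 and constants $A_D>0$ depending only on $D$, such that for all $D\ge1$, $k\ge1$, $n\ge1$, every $D$-distance $d$ on a set $X$, all data points $x_1,\dots,x_n\in X$ and every tie-breaking rule as above, the following holds. If the data points arrive in uniformly random order, then with probability at least $0.9$ both 1. the number of centers taken by the algorithm is at most $C\,k\log(n/k)$ if $n\ge 2k$, and at most $B_k\log n$ if $n\ge 2$; and 2. the cost of the set of all centers taken by the algorithm is at most $\exp\bigl(A_D\,k\log(k+1)\bigr)\cdot opt_k$. In particular, for constant $k$ and $D$ the algorithm uses $O(k\log(n/k))=O(\log n)$ centers and is an $O(1)$-approximation. -/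

import Mathlib

universe u

/-- The distance function of a `D`-cost: nonnegative, zero on the diagonal, symmetric, and
satisfying the triangle inequality up to the factor `D`. Distinct points may be at distance `0`. -/
structure IsDDistance {X : Type*} (d : X → X → ℝ) (D : ℝ) : Prop where
  nonneg : ∀ u v, 0 ≤ d u v
  self : ∀ u, d u u = 0
  symm : ∀ u v, d u v = d v u
  triangle : ∀ u v w, d u v ≤ D * (d u w + d w v)

/-- The cost of the family of centers `c` on the data points `x i`: every data point pays its
distance to the nearest center (used for a nonempty finite index type `κ`). -/
noncomputable def clusterCost {X ι κ : Type*} [Fintype ι] (d : X → X → ℝ) (x : ι → X)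
    (c : κ → X) : ℝ :=
  ∑ i, ⨅ j, d (x i) (c j)

/-- The optimal cost with `k` centers, which may be arbitrary points of the space. -/
noncomputable def optCost {X ι : Type*} [Fintype ι] (d : X → X → ℝ) (x : ι → X) (k : ℕ) : ℝ :=
  ⨅ c : Fin k → X, clusterCost d x c

/-- A rule that selects one element of every nonempty finite set of tied data points. It sees the
set only, hence not the order in which the data points arrive. -/
structure TieRule (ι : Type*) where
  pick : (T : Finset ι) → T.Nonempty → ι
  pick_mem : ∀ (T : Finset ι) (h : T.Nonempty), pick T h ∈ T

open Classical in
/-- The set `argmax_{v ∈ M - S} min_{y ∈ S} δ v y` (used for nonempty `S`). -/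
noncomputable def farthestPoints {ι : Type*} [DecidableEq ι] (δ : ι → ι → ℝ)
    (M S : Finset ι) : Finset ι :=
  (M \ S).filter fun v => ∀ w ∈ M \ S, (⨅ y : S, δ w y) ≤ ⨅ y : S, δ v y

/-- Farthest-first-traversal of `M` started at `s`, with `k` points (all points if `M` has fewer
than `k`); `δ i j` is the distance between the data points named `i` and `j`. -/
noncomputable def farthestFirst {ι : Type*} [DecidableEq ι] (δ : ι → ι → ℝ) (tie : TieRule ι)
    (M : Finset ι) (s : ι) : ℕ → Finset ι
  | 0 => ∅
  | 1 => {s}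
  | k + 2 =>
    let S := farthestFirst δ tie M s (k + 1)
    if h : (farthestPoints δ M S).Nonempty then
      insert (tie.pick (farthestPoints δ M S) h) S
    else S

/-- One step of the online algorithm on the arrival of `p`. The state consists of the list of the
points seen so far, in order of arrival, and the set of the centers taken so far. The first `k`
points are taken; a later one is taken if and only if it lies in the farthest-first-traversal,
started at the first point, of all points seen so far including itself. -/
noncomputable def onlineStep {ι : Type*} [DecidableEq ι] (δ : ι → ι → ℝ) (tie : TieRule ι)
    (k : ℕ) (state : List ι × Finset ι) (p : ι) : List ι × Finset ι :=
  let M := state.1 ++ [p]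
  if M.length ≤ k ∨ p ∈ farthestFirst δ tie M.toFinset (state.1.headD p) k then
    (M, insert p state.2)
  else (M, state.2)

/-- The centers taken by the online algorithm on a stream of data points. -/
noncomputable def onlineCenters {ι : Type*} [DecidableEq ι] (δ : ι → ι → ℝ) (tie : TieRule ι)
    (k : ℕ) (stream : List ι) : Finset ι :=
  (stream.foldl (onlineStep δ tie k) ([], ∅)).2

/-- The centers that the online algorithm takes when the data points `x 0, …, x (n - 1)` arrive in
the order `x (σ 0), x (σ 1), …`. They are recorded by their names, so equal data points with
different names count separately. -/
noncomputable def centersInOrder {X : Type*} {n : ℕ} (d : X → X → ℝ) (x : Fin n → X)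
    (tie : TieRule (Fin n)) (k : ℕ) (σ : Equiv.Perm (Fin n)) : Finset (Fin n) :=
  onlineCenters (fun i j => d (x i) (x j)) tie k (List.ofFn σ)

/-- The probability of the event `E` for a uniformly random order of `n` data points. -/
noncomputable def randomOrderProb (n : ℕ) (E : Equiv.Perm (Fin n) → Prop) : ℝ :=
  (Nat.card {σ : Equiv.Perm (Fin n) // E σ} : ℝ) / (Nat.card (Equiv.Perm (Fin n)) : ℝ)

/-! Number of centers: given the set of the first `t + 1` arrivals and the very first one, each of
the other `t` points is equally likely to come last, and at most `k` of them lie in the traversal.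
So time `t ≥ k` yields a center with probability at most `k / t` (`mul_card_mem_traversalAt_le`).
Summation over `t` and Markov's inequality finish this half.

Cost: group the points by their nearest center in a nearly optimal family of cost `O`. Outside an
event of probability 1/20, two facts hold for every cluster `P`: each point arriving no later than
all of `P` lies within `40 * k * O / |P|` of its own center, and each cluster containing such a
point has size at least `|P| / (40 * k ^ 2)`. A failure means that a set much smaller than `P` beats
all of `P`, which is unlikely (`card_mul_card_exists_forall_le`).

Now let `p` be the first arrival of `P`. If `p` is rejected, then `p` and the `k` traversal points
are `k + 1` points in `k` clusters. Two of them share a cluster, hence are close, and by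
`farthestFirst_packing` `p` is at least as close to the traversal. So `p` is near an earlier point,
and thereby near the first arrival of a cluster seen before. Iterating through at most `k` clusters
ends at a taken center (`exists_near_center`); each round costs a factor polynomial in `k`, whence
`exp (A * k * log (k + 1))`.

The optimum need not be attained, but there are only finitely many orders, so one family of centers
can be chosen close enough for all of them (`exists_nearly_optimal`). -/

open Finset

/-! ### Packing property of farthest-first-traversal -/

section FarthestFirst

variable {ι : Type*} [DecidableEq ι] {δ : ι → ι → ℝ} {tie : TieRule ι} {M : Finset ι} {s : ι}

theorem farthestPoints_subset (S : Finset ι) : farthestPoints δ M S ⊆ M \ S :=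
  filter_subset _ _

theorem farthestPoints_nonempty {S : Finset ι} (h : (M \ S).Nonempty) :
    (farthestPoints δ M S).Nonempty := by
  obtain ⟨v, hv, hmax⟩ := exists_max_image (M \ S) (fun v => ⨅ y : S, δ v y) h
  exact ⟨v, mem_filter.2 ⟨hv, hmax⟩⟩

theorem farthestFirst_subset (hs : s ∈ M) (k : ℕ) : farthestFirst δ tie M s k ⊆ M := by
  induction k using Nat.twoStepInduction with
  | zero => simp [farthestFirst]
  | one => simpa [farthestFirst] using hs
  | more k _ ih =>
    simp only [farthestFirst]
    split_ifs with h
    · refine insert_subset ?_ ih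
      exact (mem_sdiff.1 (farthestPoints_subset _ (tie.pick_mem _ h))).1
    · exact ih

theorem card_farthestFirst_le (k : ℕ) : (farthestFirst δ tie M s k).card ≤ k := by
  induction k using Nat.twoStepInduction with
  | zero => simp [farthestFirst]
  | one => simp [farthestFirst]
  | more k _ ih =>
    simp only [farthestFirst]
    split_ifs with h
    · exact (card_insert_le _ _).trans (by omega)
    · omega

/-- If a point `p` is missed by the farthest-first-traversal, then the traversal has its full
number of points, and their mutual distances are at least the distance from `p` to them. -/
theorem farthestFirst_packing (hsymm : ∀ u v, δ u v = δ v u) (hnn : ∀ u v, 0 ≤ δ u v) {p : ι}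
    (hp : p ∈ M) {ρ : ℝ} (k : ℕ) (hpk : p ∉ farthestFirst δ tie M s k)
    (hρ : ∀ y ∈ farthestFirst δ tie M s k, ρ ≤ δ p y) :
    (farthestFirst δ tie M s k).card = k ∧
      ∀ y ∈ farthestFirst δ tie M s k, ∀ z ∈ farthestFirst δ tie M s k, y ≠ z → ρ ≤ δ y z := by
  induction k using Nat.twoStepInduction with
  | zero => simp [farthestFirst]
  | one => simp +contextual [farthestFirst]
  | more k _ ih =>
    simp only [farthestFirst] at hpk hρ ⊢
    set S := farthestFirst δ tie M s (k + 1) with hS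
    have hpS : p ∉ S := by
      split_ifs at hpk
      · exact fun h => hpk (mem_insert_of_mem h)
      · exact hpk
    have hne : (farthestPoints δ M S).Nonempty :=
      farthestPoints_nonempty ⟨p, mem_sdiff.2 ⟨hp, hpS⟩⟩
    rw [dif_pos hne] at hpk hρ ⊢
    set v := tie.pick (farthestPoints δ M S) hne
    have hv := tie.pick_mem (farthestPoints δ M S) hne
    have hvS : v ∉ S := (mem_sdiff.1 (farthestPoints_subset _ hv)).2
    obtain ⟨hcard, hpack⟩ := ih hpS fun y hy => hρ y (mem_insert_of_mem hy)
    have hSne : S.Nonempty := card_pos.1 (by omega)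
    have : Nonempty S := hSne.to_subtype
    -- The missed point `p` was itself a candidate when `v` was picked, so `v` is at least as far
    -- from `S`.
    have hvρ : ∀ y ∈ S, ρ ≤ δ v y := fun y hy =>
      calc ρ ≤ ⨅ y : S, δ p y := le_ciInf fun y => hρ y (mem_insert_of_mem y.2)
        _ ≤ ⨅ y : S, δ v y := (mem_filter.1 hv).2 p (mem_sdiff.2 ⟨hp, hpS⟩)
        _ ≤ δ v y := ciInf_le (f := fun y : S => δ v y)
          ⟨0, by rintro _ ⟨y, rfl⟩; exact hnn _ _⟩ ⟨y, hy⟩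
    refine ⟨by rw [card_insert_of_notMem hvS, hcard], ?_⟩
    intro y hy z hz hyz
    rcases mem_insert.1 hy with rfl | hy <;> rcases mem_insert.1 hz with rfl | hz
    · exact absurd rfl hyz
    · exact hvρ z hz
    · rw [hsymm]; exact hvρ y hy
    · exact hpack y hy z hz hyz

end FarthestFirst

/-! ### The online algorithm unrolled in time -/

section Online

variable {ι : Type*} [DecidableEq ι] (δ : ι → ι → ℝ) (tie : TieRule ι) (k : ℕ)

theorem foldl_onlineStep_fst (L : List ι) :
    (L.foldl (onlineStep δ tie k) ([], ∅)).1 = L := by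
  induction L using List.reverseRecOn with
  | nil => rfl
  | append_singleton L p ih =>
    rw [List.foldl_append, List.foldl_cons, List.foldl_nil, onlineStep]
    simp only [ih]
    split_ifs <;> rfl

theorem mem_onlineCenters_append_singleton (L : List ι) (p q : ι) :
    q ∈ onlineCenters δ tie k (L ++ [p]) ↔ q ∈ onlineCenters δ tie k L ∨
      (q = p ∧ (L.length < k ∨ p ∈ farthestFirst δ tie (L ++ [p]).toFinset (L.headD p) k)) := by
  rw [onlineCenters, List.foldl_append, List.foldl_cons, List.foldl_nil, onlineStep,
    foldl_onlineStep_fst]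
  simp only [onlineCenters, List.length_append, List.length_singleton, Nat.succ_le_iff]
  split_ifs with h
  · simp only [mem_insert]; tauto
  · tauto

theorem mem_onlineCenters_iff (L : List ι) (q : ι) :
    q ∈ onlineCenters δ tie k L ↔ ∃ (t : ℕ) (h : t < L.length), q = L[t] ∧ (t < k ∨
      L[t] ∈ farthestFirst δ tie (L.take (t + 1)).toFinset (L.headD L[t]) k) := by
  induction L using List.reverseRecOn with
  | nil => simp [onlineCenters]
  | append_singleton L p ih =>
    rw [mem_onlineCenters_append_singleton, ih]
    constructor
    · rintro (⟨t, h, hq, hc⟩ | ⟨hq, hc⟩)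
      · have e1 : (L ++ [p])[t]'(by simp; omega) = L[t] := List.getElem_append_left h
        have e2 : (L ++ [p]).take (t + 1) = L.take (t + 1) := List.take_append_of_le_length h
        have e3 : (L ++ [p]).headD L[t] = L.headD L[t] := by
          cases L
          · simp at h
          · rfl
        exact ⟨t, by simp; omega, by rw [e1]; exact hq, by rw [e1, e2, e3]; exact hc⟩
      · refine ⟨L.length, by simp, by simpa using hq, ?_⟩
        -- For empty `L` the default `p` is the correct starting point, since `p` then arrives
        -- first.
        have e3 : (L ++ [p]).headD p = L.headD p := by cases L <;> rfl
        rw [List.getElem_concat_length (by rfl), e3, List.take_of_length_le (by simp)]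
        exact hc
    · rintro ⟨t, h, hq, hc⟩
      rcases (Nat.lt_succ_iff_lt_or_eq.1 (by simpa using h) : t < L.length ∨ t = L.length)
        with ht | rfl
      · left
        have e1 : (L ++ [p])[t] = L[t] := List.getElem_append_left ht
        have e2 : (L ++ [p]).take (t + 1) = L.take (t + 1) := List.take_append_of_le_length ht
        have e3 : (L ++ [p]).headD L[t] = L.headD L[t] := by
          cases L
          · simp at ht
          · rfl
        rw [e1] at hq
        rw [e1, e2, e3] at hc
        exact ⟨t, ht, hq, hc⟩
      · right
        have e3 : (L ++ [p]).headD p = L.headD p := by cases L <;> rfl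
        rw [List.getElem_concat_length (by rfl)] at hq
        rw [List.getElem_concat_length (by rfl), e3, List.take_of_length_le (by simp)] at hc
        exact ⟨hq, hc⟩

end Online

section Order

variable {n : ℕ} [NeZero n]

/-- The farthest-first-traversal of the points that have arrived up to time `t`. -/
noncomputable def traversalAt (δ : Fin n → Fin n → ℝ) (tie : TieRule (Fin n)) (k : ℕ)
    (σ : Equiv.Perm (Fin n)) (t : Fin n) : Finset (Fin n) :=
  farthestFirst δ tie ((Iic t).map σ.toEmbedding) (σ 0) k

theorem mem_centersInOrder_iff {X : Type*} (d : X → X → ℝ) (x : Fin n → X)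
    (tie : TieRule (Fin n)) (k : ℕ) (σ : Equiv.Perm (Fin n)) (t : Fin n) :
    σ t ∈ centersInOrder d x tie k σ ↔
      (t : ℕ) < k ∨ σ t ∈ traversalAt (fun i j => d (x i) (x j)) tie k σ t := by
  have key : ∀ t : Fin n,
      ((List.ofFn σ).take (t + 1)).toFinset = (Iic t).map σ.toEmbedding := by
    intro t
    ext i
    simp only [List.mem_toFinset, List.mem_take_iff_getElem, List.length_ofFn, List.getElem_ofFn,
      mem_map, mem_Iic, Equiv.coe_toEmbedding]
    constructor
    · rintro ⟨j, hj, rfl⟩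
      exact ⟨⟨j, by omega⟩, by rw [Fin.le_def]; simp; omega, rfl⟩
    · rintro ⟨j, hj, rfl⟩
      exact ⟨j, by rw [Fin.le_def] at hj; omega, rfl⟩
  have hhead : ∀ q, (List.ofFn σ).headD q = σ 0 := by
    intro q
    obtain ⟨m, rfl⟩ := Nat.exists_eq_succ_of_ne_zero (NeZero.ne n)
    rw [List.ofFn_succ]
    rfl
  rw [centersInOrder, mem_onlineCenters_iff]
  simp only [List.getElem_ofFn, hhead, traversalAt]
  constructor
  · rintro ⟨j, hj, hq, hc⟩
    obtain rfl : t = ⟨j, by simpa using hj⟩ := σ.injective hq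
    rw [← key]
    exact hc
  · intro hc
    rw [← key] at hc
    exact ⟨t, by simp, rfl, hc⟩

end Order

/-! ### Random orders and the expected number of centers -/

section RandomOrder

open Classical in
-- Exchanging `w` and `y` carries the orders in which `y` leads `W` injectively to those in which
-- `w` does, and these events are disjoint for distinct `w`.
theorem card_mul_card_forall_le {n : ℕ} (W : Finset (Fin n)) {y : Fin n} (hy : y ∈ W) :
    W.card * (univ.filter fun σ : Equiv.Perm (Fin n) =>
      ∀ p ∈ W, σ.symm y ≤ σ.symm p).card ≤ Fintype.card (Equiv.Perm (Fin n)) := by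
  set A : Fin n → Finset (Equiv.Perm (Fin n)) := fun w =>
    univ.filter fun σ => ∀ p ∈ W, σ.symm w ≤ σ.symm p with hA
  have hle : ∀ w ∈ W, (A y).card ≤ (A w).card := by
    intro w hw
    refine card_le_card_of_injOn (fun σ => Equiv.swap w y * σ) ?_
      (fun _ _ _ _ h => mul_left_cancel h)
    intro σ hσ
    simp only [hA, coe_filter, mem_univ, true_and, Set.mem_ofPred_eq] at hσ ⊢
    intro p hp
    have e : ∀ q, (Equiv.swap w y * σ).symm q = σ.symm (Equiv.swap w y q) := by
      intro q
      rw [Equiv.symm_apply_eq]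
      simp
    rw [e, e, Equiv.swap_apply_left]
    refine hσ _ ?_
    rw [Equiv.swap_apply_def]
    split_ifs <;> assumption
  have hdisj : (W : Set (Fin n)).PairwiseDisjoint A := by
    intro w hw w' hw' hne
    refine disjoint_left.2 fun σ h h' => hne ?_
    simp only [hA, mem_filter, mem_univ, true_and] at h h'
    exact σ.symm.injective (le_antisymm (h w' hw') (h' w hw))
  calc W.card * (A y).card = ∑ _w ∈ W, (A y).card := by rw [sum_const, smul_eq_mul]
    _ ≤ ∑ w ∈ W, (A w).card := sum_le_sum hle
    _ = (W.biUnion A).card := (card_biUnion hdisj).symm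
    _ ≤ _ := card_le_univ _

open Classical in
/-- In a uniformly random order, some point of `Z` comes before all of `P` with probability at
most `|Z| / |P|`. -/
theorem card_mul_card_exists_forall_le {n : ℕ} (P Z : Finset (Fin n)) :
    P.card * (univ.filter fun σ : Equiv.Perm (Fin n) =>
      ∃ y ∈ Z, ∀ p ∈ P, σ.symm y ≤ σ.symm p).card ≤
      Z.card * Fintype.card (Equiv.Perm (Fin n)) := by
  set A : Fin n → Finset (Equiv.Perm (Fin n)) := fun y =>
    univ.filter fun σ => ∀ p ∈ P, σ.symm y ≤ σ.symm p with hA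
  have h1 : (univ.filter fun σ : Equiv.Perm (Fin n) =>
      ∃ y ∈ Z, ∀ p ∈ P, σ.symm y ≤ σ.symm p) ⊆ Z.biUnion A := by
    intro σ
    simp [hA]
  have h2 : ∀ y ∈ Z, P.card * (A y).card ≤ Fintype.card (Equiv.Perm (Fin n)) := by
    intro y _
    -- `y` need not belong to `P`; adding it changes neither the event nor the direction of the
    -- bound.
    refine le_trans ?_ (card_mul_card_forall_le (insert y P) (mem_insert_self y P))
    refine Nat.mul_le_mul (card_le_card (subset_insert _ _)) (card_le_card ?_)
    intro σ
    simp [hA]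
  calc _ ≤ P.card * ∑ y ∈ Z, (A y).card :=
        Nat.mul_le_mul_left _ ((card_le_card h1).trans card_biUnion_le)
    _ = ∑ y ∈ Z, P.card * (A y).card := mul_sum _ _ _
    _ ≤ ∑ _y ∈ Z, Fintype.card (Equiv.Perm (Fin n)) := sum_le_sum h2
    _ = _ := by rw [sum_const, smul_eq_mul]

variable {n : ℕ} [NeZero n]

open Classical in
-- Exchanging times `l` and `t` with `0 < l ≤ t` preserves the arrived set and the starting point,
-- hence the traversal; this uses that ties ignore the order. Then double count the times `l` whose
-- point lies in it. Time `0` is left out because the start must stay fixed.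
theorem mul_card_mem_traversalAt_le (δ : Fin n → Fin n → ℝ) (tie : TieRule (Fin n)) (k : ℕ)
    (t : Fin n) :
    (t : ℕ) * (univ.filter fun σ : Equiv.Perm (Fin n) => σ t ∈ traversalAt δ tie k σ t).card ≤
      k * Fintype.card (Equiv.Perm (Fin n)) := by
  set N := (univ.filter fun σ : Equiv.Perm (Fin n) => σ t ∈ traversalAt δ tie k σ t).card with hN
  have hle : ∀ l ∈ Ioc 0 t, N ≤
      (univ.filter fun σ : Equiv.Perm (Fin n) => σ l ∈ traversalAt δ tie k σ t).card := by
    intro l hl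
    obtain ⟨hl0, hlt⟩ := mem_Ioc.1 hl
    refine card_le_card_of_injOn (fun σ => σ * Equiv.swap l t) ?_
      (fun _ _ _ _ h => mul_right_cancel h)
    intro σ hσ
    simp only [coe_filter, mem_univ, true_and, Set.mem_ofPred_eq] at hσ ⊢
    have e0 : (σ * Equiv.swap l t) 0 = σ 0 := by
      rw [Equiv.Perm.mul_apply, Equiv.swap_apply_of_ne_of_ne hl0.ne (hl0.trans_le hlt).ne]
    have e1 : (Iic t).map (σ * Equiv.swap l t).toEmbedding = (Iic t).map σ.toEmbedding := by
      have hs : ∀ i ∈ Iic t, Equiv.swap l t i ∈ Iic t := by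
        intro i hi
        rw [Equiv.swap_apply_def]
        split_ifs
        · simp
        · simpa using hlt
        · exact hi
      ext i
      simp only [mem_map, Equiv.coe_toEmbedding, Equiv.Perm.mul_apply]
      constructor
      · rintro ⟨j, hj, rfl⟩
        exact ⟨_, hs j hj, rfl⟩
      · rintro ⟨j, hj, rfl⟩
        exact ⟨_, hs j hj, by simp⟩
    rw [traversalAt, e0, e1, Equiv.Perm.mul_apply, Equiv.swap_apply_left]
    exact hσ
  have hσ : ∀ σ : Equiv.Perm (Fin n),
      ((Ioc 0 t).filter fun l => σ l ∈ traversalAt δ tie k σ t).card ≤ k := by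
    intro σ
    refine le_trans ?_ (card_farthestFirst_le (δ := δ) (tie := tie)
      (M := (Iic t).map σ.toEmbedding) (s := σ 0) k)
    refine card_le_card_of_injOn σ ?_ σ.injective.injOn
    intro l hl
    exact (mem_filter.1 hl).2
  calc (t : ℕ) * N = ∑ _l ∈ Ioc 0 t, N := by rw [sum_const, smul_eq_mul, Fin.card_Ioc]; simp
    _ ≤ ∑ l ∈ Ioc 0 t,
        (univ.filter fun σ : Equiv.Perm (Fin n) => σ l ∈ traversalAt δ tie k σ t).card :=
      sum_le_sum hle
    _ = ∑ σ : Equiv.Perm (Fin n),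
        ((Ioc 0 t).filter fun l => σ l ∈ traversalAt δ tie k σ t).card :=
      sum_card_bipartiteAbove_eq_sum_card_bipartiteBelow
        (fun l (σ : Equiv.Perm (Fin n)) => σ l ∈ traversalAt δ tie k σ t)
    _ ≤ ∑ _σ : Equiv.Perm (Fin n), k := sum_le_sum fun σ _ => hσ σ
    _ = _ := by rw [sum_const, smul_eq_mul, card_univ, mul_comm]

theorem sum_Ico_inv_le_log {k : ℕ} (hk : 1 ≤ k) (m : ℕ) (hkm : k ≤ m) :
    ∑ t ∈ Ico k m, (1 / (t : ℝ)) ≤ 1 / k + Real.log ((m : ℝ) / k) := by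
  have hk0 : (0 : ℝ) < k := by exact_mod_cast hk
  -- With the extra `- 1 / m` the induction step becomes `1 / (m + 1) ≤ log ((m + 1) / m)`.
  suffices h : ∑ t ∈ Ico k m, (1 / (t : ℝ)) ≤ 1 / k - 1 / m + Real.log ((m : ℝ) / k) by
    have : (0 : ℝ) ≤ 1 / m := by positivity
    linarith
  induction m, hkm using Nat.le_induction with
  | base => simp [hk0.ne']
  | succ m hkm ih =>
    have hm0 : (0 : ℝ) < m := hk0.trans_le (by exact_mod_cast hkm)
    rw [sum_Ico_succ_top hkm]
    have h1 : Real.log (((m + 1 : ℕ) : ℝ) / k) = Real.log ((m : ℝ) / k)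
        - Real.log ((m : ℝ) / (m + 1)) := by
      rw [← Real.log_div (by positivity) (by positivity)]
      congr 1
      push_cast
      field_simp
    have h2 := Real.log_le_sub_one_of_pos (show (0 : ℝ) < (m : ℝ) / (m + 1) by positivity)
    have h3 : (m : ℝ) / (m + 1) - 1 = - (1 / ((m : ℝ) + 1)) := by field_simp; ring
    rw [h1]
    push_cast
    linarith

variable {X : Type*} (d : X → X → ℝ) (x : Fin n → X) (tie : TieRule (Fin n))

theorem sum_card_centersInOrder_le {k : ℕ} (hk : 1 ≤ k) (hkn : k ≤ n) :
    ∑ σ : Equiv.Perm (Fin n), ((centersInOrder d x tie k σ).card : ℝ) ≤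
      Fintype.card (Equiv.Perm (Fin n)) * (2 * k + k * Real.log ((n : ℝ) / k)) := by
  classical
  have hk0 : (0 : ℝ) < k := by exact_mod_cast hk
  set N : ℝ := (Fintype.card (Equiv.Perm (Fin n)) : ℝ) with hN
  have hN0 : 0 ≤ N := by positivity
  have h1 : ∀ σ : Equiv.Perm (Fin n), (centersInOrder d x tie k σ).card =
      (univ.filter fun t : Fin n => σ t ∈ centersInOrder d x tie k σ).card := by
    intro σ
    rw [← card_map σ.symm.toEmbedding]
    congr 1
    ext t
    simp only [mem_map, Equiv.coe_toEmbedding, mem_filter, mem_univ, true_and]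
    constructor
    · rintro ⟨a, ha, rfl⟩
      simpa using ha
    · exact fun h => ⟨_, h, by simp⟩
  have h2 : ∑ σ : Equiv.Perm (Fin n), (centersInOrder d x tie k σ).card =
      ∑ t : Fin n, (univ.filter fun σ : Equiv.Perm (Fin n) =>
        σ t ∈ centersInOrder d x tie k σ).card := by
    simp_rw [h1]
    exact (sum_card_bipartiteAbove_eq_sum_card_bipartiteBelow (s := univ) (t := univ)
      (fun (σ : Equiv.Perm (Fin n)) (t : Fin n) => σ t ∈ centersInOrder d x tie k σ))
  have h3 : ∀ t : Fin n, ((univ.filter fun σ : Equiv.Perm (Fin n) =>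
      σ t ∈ centersInOrder d x tie k σ).card : ℝ) ≤
      (fun t : ℕ => if t < k then N else k * N * (1 / t)) t := by
    intro t
    dsimp only
    split_ifs with ht
    · rw [hN]
      exact_mod_cast card_le_univ _
    · simp only [mem_centersInOrder_iff, ht, false_or]
      have ht0 : (0 : ℝ) < (t : ℕ) := by exact_mod_cast (by omega : 0 < (t : ℕ))
      rw [mul_one_div, le_div_iff₀ ht0, mul_comm, hN]
      exact_mod_cast mul_card_mem_traversalAt_le (fun i j => d (x i) (x j)) tie k t
  have h4 : ∑ t ∈ range n, (if t < k then N else k * N * (1 / (t : ℝ))) =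
      k * N + k * N * ∑ t ∈ Ico k n, (1 / (t : ℝ)) := by
    rw [range_eq_Ico, ← sum_Ico_consecutive _ (Nat.zero_le k) hkn, mul_sum]
    congr 1
    · rw [sum_congr rfl fun t ht => if_pos (mem_Ico.1 ht).2]
      simp
    · exact sum_congr rfl fun t ht => if_neg (mem_Ico.1 ht).1.not_gt
  have h5 := sum_Ico_inv_le_log hk n hkn
  have hk1 : (1 : ℝ) ≤ k := by exact_mod_cast hk
  calc _ = ((∑ σ : Equiv.Perm (Fin n), (centersInOrder d x tie k σ).card : ℕ) : ℝ) := by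
        push_cast; rfl
    _ = ∑ t : Fin n, ((univ.filter fun σ : Equiv.Perm (Fin n) =>
        σ t ∈ centersInOrder d x tie k σ).card : ℝ) := by rw [h2]; push_cast; rfl
    _ ≤ ∑ t : Fin n, (fun t : ℕ => if t < k then N else k * N * (1 / t)) t :=
      sum_le_sum fun t _ => h3 t
    _ = k * N + k * N * ∑ t ∈ Ico k n, (1 / (t : ℝ)) := by
      rw [← h4]
      exact Fin.sum_univ_eq_sum_range (fun t : ℕ => if t < k then N else k * N * (1 / (t : ℝ))) n
    _ ≤ k * N + k * N * (1 / k + Real.log ((n : ℝ) / k)) := by gcongr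
    _ = N * (k + 1 + k * Real.log ((n : ℝ) / k)) := by field_simp; ring
    _ ≤ _ := by gcongr; linarith

open Classical in
theorem card_many_centers_le {k : ℕ} (hk : 1 ≤ k) (hkn : k ≤ n) :
    20 * ((univ.filter fun σ : Equiv.Perm (Fin n) =>
      20 * (2 * k + k * Real.log ((n : ℝ) / k)) <
        ((centersInOrder d x tie k σ).card : ℝ)).card : ℝ) ≤
      Fintype.card (Equiv.Perm (Fin n)) := by
  have hk0 : (0 : ℝ) < k := by exact_mod_cast hk
  have hlog : 0 ≤ Real.log ((n : ℝ) / k) :=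
    Real.log_nonneg ((one_le_div hk0).2 (by exact_mod_cast hkn))
  set μ := 2 * k + k * Real.log ((n : ℝ) / k) with hμ
  have hμ0 : 0 < μ := by positivity
  set Bad := univ.filter fun σ : Equiv.Perm (Fin n) =>
      20 * μ < ((centersInOrder d x tie k σ).card : ℝ) with hBad
  have h : (Bad.card : ℝ) * (20 * μ) ≤ Fintype.card (Equiv.Perm (Fin n)) * μ :=
    calc (Bad.card : ℝ) * (20 * μ) = ∑ _σ ∈ Bad, 20 * μ := by rw [sum_const, nsmul_eq_mul]
      _ ≤ ∑ σ ∈ Bad, ((centersInOrder d x tie k σ).card : ℝ) :=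
        sum_le_sum fun σ hσ => (mem_filter.1 hσ).2.le
      _ ≤ ∑ σ : Equiv.Perm (Fin n), ((centersInOrder d x tie k σ).card : ℝ) :=
        sum_le_sum_of_subset_of_nonneg (subset_univ _) fun _ _ _ => by positivity
      _ ≤ _ := sum_card_centersInOrder_le d x tie hk hkn
  refine le_of_mul_le_mul_right ?_ hμ0
  linarith

end RandomOrder

/-! ### Deterministic cost bound for a favorable order -/

section Approximation

variable {n : ℕ} [NeZero n] {X : Type*} {d : X → X → ℝ} {D : ℝ} {x : Fin n → X}
  {tie : TieRule (Fin n)} {k : ℕ} {σ : Equiv.Perm (Fin n)} {c : Fin k → X} {a : Fin n → Fin k}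
  {K K' O : ℝ}

/-- The cluster of the points that the assignment `a` sends to `j`. -/
def clusterOf (a : Fin n → Fin k) (j : Fin k) : Finset (Fin n) := univ.filter fun i => a i = j

/-- If the first point of a cluster is not taken, then it is close to a point of the current
traversal, because two points of the same cluster are far apart. -/
theorem exists_near_traversalAt (hd : IsDDistance d D) (hD : 1 ≤ D) (hk : 1 ≤ k)
    (hE : ∀ j y, (∀ p ∈ clusterOf a j, σ.symm y ≤ σ.symm p) →
      ((clusterOf a j).card : ℝ) * d (x y) (c (a y)) ≤ K * O)
    {t : Fin n} (hfirst : ∀ p ∈ clusterOf a (a (σ t)), t ≤ σ.symm p)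
    (ht : σ t ∉ centersInOrder d x tie k σ) :
    ∃ u < t, ((clusterOf a (a (σ t))).card : ℝ) * d (x (σ t)) (x (σ u)) ≤ 2 * D * K * O := by
  rw [mem_centersInOrder_iff, not_or] at ht
  set δ : Fin n → Fin n → ℝ := fun i j => d (x i) (x j)
  set m : ℝ := ((clusterOf a (a (σ t))).card : ℝ)
  set S := traversalAt δ tie k σ t with hS
  have hSM : S ⊆ (Iic t).map σ.toEmbedding :=
    farthestFirst_subset (mem_map.2 ⟨0, by simp, rfl⟩) k
  have htM : σ t ∈ (Iic t).map σ.toEmbedding := mem_map.2 ⟨t, by simp, rfl⟩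
  have hM : ∀ y ∈ (Iic t).map σ.toEmbedding, σ.symm y ≤ t := by
    intro y hy
    obtain ⟨u, hu, rfl⟩ := mem_map.1 hy
    simpa using hu
  have hpack := fun (ρ : ℝ) (hρ : ∀ y ∈ S, ρ ≤ δ (σ t) y) =>
    farthestFirst_packing (δ := δ) (tie := tie) (s := σ 0)
      (fun _ _ => hd.symm _ _) (fun _ _ => hd.nonneg _ _) htM k ht.2 hρ
  have hcard : S.card = k := (hpack 0 fun _ _ => hd.nonneg _ _).1
  obtain ⟨y, hyS, hymin⟩ := exists_min_image S (δ (σ t)) (card_pos.1 (by omega))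
  have hfar := (hpack (δ (σ t) y) hymin).2
  have hyt : σ.symm y ≠ t := by
    rintro rfl
    exact ht.2 (by simpa using hyS)
  refine ⟨σ.symm y, lt_of_le_of_ne (hM y (hSM hyS)) hyt, ?_⟩
  rw [Equiv.apply_symm_apply]
  -- Pigeonhole: `k + 1` points, `k` clusters.
  obtain ⟨u, hu, v, hv, huv, hauv⟩ := exists_ne_map_eq_of_card_lt_of_maps_to
    (s := insert (σ t) S) (t := (univ : Finset (Fin k))) (f := a)
    (by rw [card_insert_of_notMem ht.2, hcard, card_univ, Fintype.card_fin]; omega)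
    (fun _ _ => mem_coe.2 (mem_univ _))
  -- The weight is the size of the cluster of `σ t`, not of that of `w`: all these points arrive no
  -- later than any point of the former.
  have hT : ∀ w ∈ insert (σ t) S, m * d (x w) (c (a w)) ≤ K * O := by
    intro w hw
    refine hE _ _ fun p hp => le_trans ?_ (hfirst p hp)
    rcases mem_insert.1 hw with rfl | hw
    · simp
    · exact hM w (hSM hw)
  have hρ : δ (σ t) y ≤ d (x u) (x v) := by
    rcases mem_insert.1 hu with rfl | hu <;> rcases mem_insert.1 hv with rfl | hv
    · exact absurd rfl huv
    · exact hymin v hv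
    · rw [hd.symm]; exact hymin u hu
    · exact hfar u hu v hv huv
  have htri := hd.triangle (x u) (x v) (c (a u))
  have h1 := hT u hu
  have h2 := hT v hv
  rw [← hauv, hd.symm] at h2
  have hm : 0 ≤ m := Nat.cast_nonneg _
  calc m * d (x (σ t)) (x y) ≤ m * (D * (d (x u) (c (a u)) + d (c (a u)) (x v))) :=
        mul_le_mul_of_nonneg_left (hρ.trans htri) hm
    _ = D * (m * d (x u) (c (a u)) + m * d (c (a u)) (x v)) := by ring
    _ ≤ D * (K * O + K * O) := by gcongr
    _ = _ := by ring

/-- Induction on the number of clusters seen up to time `t`: passing to the first arrival of the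
cluster of a nearby earlier point loses at least the cluster of `σ t`. -/
theorem exists_near_center (hd : IsDDistance d D) (hD : 1 ≤ D) (hk : 1 ≤ k) (hK : 0 ≤ K)
    (hK' : 0 ≤ K') (hO : 0 ≤ O)
    (hE : ∀ j y, (∀ p ∈ clusterOf a j, σ.symm y ≤ σ.symm p) →
      ((clusterOf a j).card : ℝ) * d (x y) (c (a y)) ≤ K * O)
    (hF : ∀ i j, (∃ y ∈ clusterOf a i, ∀ p ∈ clusterOf a j, σ.symm y ≤ σ.symm p) →
      ((clusterOf a j).card : ℝ) ≤ K' * (clusterOf a i).card)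
    (hβ : 1 ≤ D ^ 3 * (4 * K + K')) (r : ℕ) :
    ∀ t : Fin n, (∀ p ∈ clusterOf a (a (σ t)), t ≤ σ.symm p) →
      ((Iic t).image (a ∘ σ)).card ≤ r →
      ∃ q ∈ centersInOrder d x tie k σ, ((clusterOf a (a (σ t))).card : ℝ) *
        d (x (σ t)) (x q) ≤ (D ^ 3 * (4 * K + K')) ^ r * O := by
  set β := D ^ 3 * (4 * K + K') with hβdef
  induction r with
  | zero =>
    intro t _ ht
    have : 0 < ((Iic t).image (a ∘ σ)).card := card_pos.2 ⟨_, mem_image_of_mem _ (by simp : t ∈ Iic t)⟩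
    omega
  | succ r ih =>
    intro t hfirst hr
    by_cases ht : σ t ∈ centersInOrder d x tie k σ
    · refine ⟨σ t, ht, ?_⟩
      rw [hd.self, mul_zero]
      positivity
    obtain ⟨u, hut, hu⟩ := exists_near_traversalAt hd hD hk hE hfirst ht
    set i := a (σ u)
    obtain ⟨p, hp, hpmin⟩ := exists_min_image (clusterOf a i) σ.symm
      ⟨σ u, mem_filter.2 ⟨mem_univ _, rfl⟩⟩
    have hai : a p = i := by simpa [clusterOf] using hp
    set v := σ.symm p
    have hpv : p = σ v := (σ.apply_symm_apply p).symm
    have hvu : v ≤ u :=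
      (hpmin (σ u) (mem_filter.2 ⟨mem_univ _, rfl⟩)).trans_eq (σ.symm_apply_apply u)
    have hvt : v < t := hvu.trans_lt hut
    have hnot : a (σ t) ∉ (Iic v).image (a ∘ σ) := by
      rw [mem_image]
      rintro ⟨w, hw, hwt⟩
      have := hfirst (σ w) (by simpa [clusterOf] using hwt)
      rw [Equiv.symm_apply_apply] at this
      exact absurd ((this.trans (mem_Iic.1 hw)).trans_lt hvt) (lt_irrefl _)
    have hlt : ((Iic v).image (a ∘ σ)).card < ((Iic t).image (a ∘ σ)).card := by
      refine card_lt_card ((ssubset_iff_of_subset ?_).2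
        ⟨a (σ t), mem_image_of_mem (a ∘ σ) (by simp : t ∈ Iic t), hnot⟩)
      exact image_subset_image (Iic_subset_Iic.2 hvt.le)
    obtain ⟨q, hq, hqle⟩ := ih v (by rw [← hpv, hai]; exact hpmin) (by omega)
    refine ⟨q, hq, ?_⟩
    rw [← hpv, hai] at hqle
    set m : ℝ := ((clusterOf a (a (σ t))).card : ℝ)
    set m' : ℝ := ((clusterOf a i).card : ℝ)
    have hm : 0 ≤ m := Nat.cast_nonneg _
    -- The induction hypothesis is weighted by the size of the earlier cluster; this converts it to
    -- the current weight.
    have hmm : m ≤ K' * m' := hF i (a (σ t)) ⟨p, hp, fun p' hp' => hvt.le.trans (hfirst p' hp')⟩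
    have hEu : m * d (x (σ u)) (c i) ≤ K * O :=
      hE _ _ fun p' hp' => by
        rw [Equiv.symm_apply_apply]; exact hut.le.trans (hfirst p' hp')
    have hEp : m * d (c i) (x p) ≤ K * O := by
      rw [hd.symm, ← hai]
      exact hE _ _ fun p' hp' => hvt.le.trans (hfirst p' hp')
    have hpq : m * d (x p) (x q) ≤ K' * (β ^ r * O) :=
      calc m * d (x p) (x q) ≤ K' * m' * d (x p) (x q) :=
            mul_le_mul_of_nonneg_right hmm (hd.nonneg _ _)
        _ = K' * (m' * d (x p) (x q)) := by ring
        _ ≤ _ := by gcongr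
    have t1 := hd.triangle (x (σ t)) (x q) (x (σ u))
    have t2 := hd.triangle (x (σ u)) (x q) (c i)
    have t3 := hd.triangle (c i) (x q) (x p)
    have hD0 : 0 ≤ D := by linarith
    have hβr : 1 ≤ β ^ r := one_le_pow₀ hβ
    have hD2 : D ^ 2 ≤ D ^ 3 := pow_le_pow_right₀ hD (by norm_num)
    have hKO : 0 ≤ K * O := by positivity
    -- The path runs from `σ t` through `σ u`, the center of its cluster, and the first arrival `p`,
    -- to `q`; three triangle inequalities give `D ^ 3`.
    calc m * d (x (σ t)) (x q)
        ≤ m * (D * (d (x (σ t)) (x (σ u)) + D * (d (x (σ u)) (c i) +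
            D * (d (c i) (x p) + d (x p) (x q))))) := by
          refine mul_le_mul_of_nonneg_left (t1.trans ?_) hm
          gcongr
          refine t2.trans ?_
          gcongr
      _ = D * (m * d (x (σ t)) (x (σ u))) + D ^ 2 * (m * d (x (σ u)) (c i)) +
          D ^ 3 * (m * d (c i) (x p)) + D ^ 3 * (m * d (x p) (x q)) := by ring
      _ ≤ D * (2 * D * K * O) + D ^ 2 * (K * O) + D ^ 3 * (K * O) +
          D ^ 3 * (K' * (β ^ r * O)) := by gcongr
      _ = D ^ 2 * (3 * (K * O)) + D ^ 3 * (K * O) + D ^ 3 * (K' * (β ^ r * O)) := by ring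
      _ ≤ D ^ 3 * (3 * (K * O)) + D ^ 3 * (K * O) + D ^ 3 * (K' * (β ^ r * O)) := by gcongr
      _ = D ^ 3 * (4 * K * 1 + K' * β ^ r) * O := by ring
      _ ≤ D ^ 3 * (4 * K * β ^ r + K' * β ^ r) * O := by gcongr
      _ = β ^ (r + 1) * O := by rw [hβdef]; ring

/-- All points of a cluster are routed through its center and its first arrival to one taken center.
The bounds for the last two legs are already weighted by the cluster size, so summation costs
nothing more. -/
theorem clusterCost_centersInOrder_le (hd : IsDDistance d D) (hD : 1 ≤ D) (hk : 1 ≤ k)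
    (hK : 0 ≤ K) (hK' : 0 ≤ K') (hO : ∑ i, d (x i) (c (a i)) = O)
    (hE : ∀ j y, (∀ p ∈ clusterOf a j, σ.symm y ≤ σ.symm p) →
      ((clusterOf a j).card : ℝ) * d (x y) (c (a y)) ≤ K * O)
    (hF : ∀ i j, (∃ y ∈ clusterOf a i, ∀ p ∈ clusterOf a j, σ.symm y ≤ σ.symm p) →
      ((clusterOf a j).card : ℝ) ≤ K' * (clusterOf a i).card)
    (hβ : 1 ≤ D ^ 3 * (4 * K + K')) :
    clusterCost d x (fun q : ↥(centersInOrder d x tie k σ) => x q) ≤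
      (D + k * (D ^ 2 * (K + (D ^ 3 * (4 * K + K')) ^ k))) * O := by
  set β := D ^ 3 * (4 * K + K') with hβdef
  have hO0 : 0 ≤ O := hO ▸ sum_nonneg fun i _ => hd.nonneg _ _
  have hD0 : 0 ≤ D := by linarith
  have hj : ∀ j, ∑ i ∈ clusterOf a j,
      (⨅ q : ↥(centersInOrder d x tie k σ), d (x i) (x q)) ≤
      D * ∑ i ∈ clusterOf a j, d (x i) (c (a i)) + D ^ 2 * (K + β ^ k) * O := by
    intro j
    rcases (clusterOf a j).eq_empty_or_nonempty with h0 | hne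
    · rw [h0, sum_empty, sum_empty]
      positivity
    obtain ⟨p, hp, hpmin⟩ := exists_min_image (clusterOf a j) σ.symm hne
    have haj : a p = j := by simpa [clusterOf] using hp
    obtain ⟨q, hq, hqle⟩ := exists_near_center (tie := tie) hd hD hk hK hK' hO0 hE hF hβ k
      (σ.symm p) (by simpa [haj] using hpmin) ((card_le_univ _).trans (by simp))
    rw [Equiv.apply_symm_apply, haj] at hqle
    have hEp := hE j p hpmin
    rw [haj, hd.symm] at hEp
    set m : ℝ := ((clusterOf a j).card : ℝ)
    have hi : ∀ i ∈ clusterOf a j, (⨅ q : ↥(centersInOrder d x tie k σ), d (x i) (x q)) ≤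
        D * d (x i) (c (a i)) + D ^ 2 * (d (c j) (x p) + d (x p) (x q)) := by
      intro i hi
      have hai : a i = j := by simpa [clusterOf] using hi
      calc (⨅ q : ↥(centersInOrder d x tie k σ), d (x i) (x q)) ≤ d (x i) (x q) :=
            ciInf_le (f := fun q : ↥(centersInOrder d x tie k σ) => d (x i) (x q))
              ⟨0, by rintro _ ⟨q, rfl⟩; exact hd.nonneg _ _⟩ ⟨q, hq⟩
        _ ≤ D * (d (x i) (c j) + D * (d (c j) (x p) + d (x p) (x q))) := by
          refine (hd.triangle _ _ (c j)).trans ?_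
          gcongr
          exact hd.triangle _ _ _
        _ = _ := by rw [hai]; ring
    calc _ ≤ ∑ i ∈ clusterOf a j, (D * d (x i) (c (a i)) +
          D ^ 2 * (d (c j) (x p) + d (x p) (x q))) := sum_le_sum hi
      _ = D * ∑ i ∈ clusterOf a j, d (x i) (c (a i)) +
          D ^ 2 * (m * d (c j) (x p) + m * d (x p) (x q)) := by
        rw [sum_add_distrib, sum_const, nsmul_eq_mul, ← mul_sum]; ring
      _ ≤ D * ∑ i ∈ clusterOf a j, d (x i) (c (a i)) + D ^ 2 * (K * O + β ^ k * O) := by gcongr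
      _ = _ := by ring
  have hfib : ∀ f : Fin n → ℝ, ∑ i, f i = ∑ j, ∑ i ∈ clusterOf a j, f i := fun f =>
    (sum_fiberwise univ a f).symm
  rw [clusterCost, hfib]
  calc _ ≤ ∑ j, (D * ∑ i ∈ clusterOf a j, d (x i) (c (a i)) + D ^ 2 * (K + β ^ k) * O) :=
        sum_le_sum fun j _ => hj j
    _ = D * O + k * (D ^ 2 * (K + β ^ k) * O) := by
      rw [sum_add_distrib, ← mul_sum, ← hfib, hO, sum_const, card_univ, Fintype.card_fin,
        nsmul_eq_mul]
    _ = _ := by ring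

end Approximation

/-! ### Union bounds, constants and the limit to the optimum -/

section Main

open Classical in
theorem mul_card_exists_forall_le_of_le {n : ℕ} {P Z : Finset (Fin n)} {K : ℝ}
    (h : K * Z.card ≤ P.card) :
    K * ((univ.filter fun σ : Equiv.Perm (Fin n) =>
      ∃ y ∈ Z, ∀ p ∈ P, σ.symm y ≤ σ.symm p).card : ℝ) ≤
      Fintype.card (Equiv.Perm (Fin n)) := by
  set b : ℝ := ((univ.filter fun σ : Equiv.Perm (Fin n) =>
      ∃ y ∈ Z, ∀ p ∈ P, σ.symm y ≤ σ.symm p).card : ℝ) with hb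
  have hb0 : 0 ≤ b := by positivity
  rcases Z.eq_empty_or_nonempty with rfl | hZ
  · simp [hb]
  · have hZ0 : (0 : ℝ) < Z.card := by exact_mod_cast card_pos.2 hZ
    have h1 : (P.card : ℝ) * b ≤ Z.card * (Fintype.card (Equiv.Perm (Fin n)) : ℝ) := by
      rw [hb]
      exact_mod_cast card_mul_card_exists_forall_le P Z
    refine le_of_mul_le_mul_left ?_ hZ0
    calc (Z.card : ℝ) * (K * b) = K * Z.card * b := by ring
      _ ≤ P.card * b := by gcongr
      _ ≤ _ := h1

theorem nine_tenths_le_randomOrderProb {n : ℕ} {E : Equiv.Perm (Fin n) → Prop}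
    (Bad₁ Bad₂ : Finset (Equiv.Perm (Fin n)))
    (h₁ : 20 * (Bad₁.card : ℝ) ≤ Fintype.card (Equiv.Perm (Fin n)))
    (h₂ : 20 * (Bad₂.card : ℝ) ≤ Fintype.card (Equiv.Perm (Fin n)))
    (hE : ∀ σ, σ ∉ Bad₁ → σ ∉ Bad₂ → E σ) : 9 / 10 ≤ randomOrderProb n E := by
  classical
  have hN : (0 : ℝ) < Fintype.card (Equiv.Perm (Fin n)) := by
    exact_mod_cast Fintype.card_pos
  rw [randomOrderProb, Nat.card_eq_fintype_card, Nat.card_eq_fintype_card, Fintype.card_subtype,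
    le_div_iff₀ hN]
  have h : (univ : Finset (Equiv.Perm (Fin n))) ⊆ (Bad₁ ∪ Bad₂) ∪ univ.filter E := by
    intro σ _
    by_cases h1 : σ ∈ Bad₁
    · simp [h1]
    by_cases h2 : σ ∈ Bad₂
    · simp [h2]
    simp [hE σ h1 h2]
  have h3 := (card_le_card h).trans ((card_union_le _ _).trans
    (Nat.add_le_add_right (card_union_le _ _) _))
  rw [card_univ] at h3
  have h4 : (Fintype.card (Equiv.Perm (Fin n)) : ℝ) ≤ Bad₁.card + Bad₂.card +
    (univ.filter E).card := by exact_mod_cast h3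
  linarith

variable {n : ℕ} [NeZero n] {X : Type*} {d : X → X → ℝ} {D : ℝ} (x : Fin n → X)
  (tie : TieRule (Fin n)) {k : ℕ}

/-- For `2 * k ≤ n` the additive `2 * k` is absorbed because `log (n / k) ≥ log 2`; for smaller `n`
the trivial bound `n` suffices. -/
theorem exists_few_exceptions_card (d : X → X → ℝ) (hk : 1 ≤ k) :
    ∃ Bad : Finset (Equiv.Perm (Fin n)), 20 * (Bad.card : ℝ) ≤ Fintype.card (Equiv.Perm (Fin n)) ∧
      ∀ σ ∉ Bad, (2 * k ≤ n → ((centersInOrder d x tie k σ).card : ℝ) ≤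
          20 * (2 / Real.log 2 + 1) * (k * Real.log ((n : ℝ) / (k : ℝ)))) ∧
        (2 ≤ n → ((centersInOrder d x tie k σ).card : ℝ) ≤
          (20 * (2 / Real.log 2 + 1) * k + 2 * k / Real.log 2) * Real.log n) := by
  classical
  have hk0 : (0 : ℝ) < k := by exact_mod_cast hk
  have hk1 : (1 : ℝ) ≤ k := by exact_mod_cast hk
  have hl2 : 0 < Real.log 2 := Real.log_pos (by norm_num)
  by_cases hkn : 2 * k ≤ n
  · have hkn' : (2 : ℝ) * k ≤ n := by exact_mod_cast hkn
    refine ⟨_, card_many_centers_le d x tie hk (by omega), fun σ hσ => ?_⟩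
    simp only [mem_filter, mem_univ, true_and, not_lt] at hσ
    have h1 : Real.log 2 ≤ Real.log ((n : ℝ) / k) :=
      Real.log_le_log (by norm_num) ((le_div_iff₀ hk0).2 hkn')
    have h2 : Real.log ((n : ℝ) / k) ≤ Real.log n :=
      Real.log_le_log (div_pos (by linarith) hk0) (div_le_self (by positivity) hk1)
    have h3 : ((centersInOrder d x tie k σ).card : ℝ) ≤
        20 * (2 / Real.log 2 + 1) * (k * Real.log ((n : ℝ) / (k : ℝ))) := by
      refine hσ.trans ?_
      have : 2 * (k : ℝ) ≤ 2 / Real.log 2 * (k * Real.log ((n : ℝ) / k)) :=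
        calc 2 * (k : ℝ) = 2 / Real.log 2 * (k * Real.log 2) := by field_simp
          _ ≤ _ := by gcongr
      linarith
    refine ⟨fun _ => h3, fun _ => h3.trans ?_⟩
    have h4 : 0 ≤ Real.log n := by linarith
    calc 20 * (2 / Real.log 2 + 1) * (k * Real.log ((n : ℝ) / (k : ℝ)))
        ≤ 20 * (2 / Real.log 2 + 1) * (k * Real.log n) := by gcongr
      _ ≤ 20 * (2 / Real.log 2 + 1) * (k * Real.log n) + 2 * k / Real.log 2 * Real.log n :=
        le_add_of_nonneg_right (by positivity)
      _ = _ := by ring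
  · refine ⟨∅, by simp, fun σ _ => ⟨fun h => absurd h hkn, fun hn => ?_⟩⟩
    have h1 : ((centersInOrder d x tie k σ).card : ℝ) ≤ n := by
      exact_mod_cast (card_le_univ _).trans (by simp)
    have h2 : (n : ℝ) ≤ 2 * k := by exact_mod_cast (by omega : n ≤ 2 * k)
    have h3 : Real.log 2 ≤ Real.log n := Real.log_le_log (by norm_num) (by exact_mod_cast hn)
    have h4 : 0 ≤ Real.log n := by linarith
    calc _ ≤ 2 * (k : ℝ) := h1.trans h2
      _ = 2 * k / Real.log 2 * Real.log 2 := by field_simp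
      _ ≤ 2 * k / Real.log 2 * Real.log n := by gcongr
      _ ≤ 20 * (2 / Real.log 2 + 1) * k * Real.log n + 2 * k / Real.log 2 * Real.log n :=
        le_add_of_nonneg_left (by positivity)
      _ = _ := by ring

/-- The approximation factor obtained from the order of arrival of the clusters. -/
noncomputable def approxFactor (D : ℝ) (k : ℕ) : ℝ :=
  D + k * (D ^ 2 * (40 * k + (D ^ 3 * (4 * (40 * k) + 40 * k ^ 2)) ^ k))

/-- The constants `40 * k` and `40 * k ^ 2` make the union bounds over `k` clusters and `k ^ 2`
pairs cost 1/40 each. -/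
theorem exists_few_exceptions_cost (hd : IsDDistance d D) (hD : 1 ≤ D) (hk : 1 ≤ k)
    (c : Fin k → X) :
    ∃ Bad : Finset (Equiv.Perm (Fin n)), 20 * (Bad.card : ℝ) ≤ Fintype.card (Equiv.Perm (Fin n)) ∧
      ∀ σ ∉ Bad, clusterCost d x (fun q : ↥(centersInOrder d x tie k σ) => x q) ≤
        approxFactor D k * clusterCost d x c := by
  classical
  have hk0 : (0 : ℝ) < k := by exact_mod_cast hk
  have hk1 : (1 : ℝ) ≤ k := by exact_mod_cast hk
  have : Nonempty (Fin k) := ⟨⟨0, hk⟩⟩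
  choose a ha using fun i => exists_eq_ciInf_of_finite (f := fun j => d (x i) (c j))
  set O := clusterCost d x c with hOdef
  have hO : ∑ i, d (x i) (c (a i)) = O := sum_congr rfl fun i _ => ha i
  set N : ℝ := (Fintype.card (Equiv.Perm (Fin n)) : ℝ) with hN
  set P := clusterOf a
  set Z : Fin k → Finset (Fin n) := fun j =>
    univ.filter fun y => 40 * k * O < (P j).card * d (x y) (c (a y)) with hZ
  set before : Finset (Fin n) → Finset (Fin n) → Finset (Equiv.Perm (Fin n)) := fun P Z =>
    univ.filter fun σ => ∃ y ∈ Z, ∀ p ∈ P, σ.symm y ≤ σ.symm p with hbefore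
  set BadF : Fin k × Fin k → Finset (Equiv.Perm (Fin n)) := fun ij =>
    if ((P ij.2).card : ℝ) ≤ 40 * k ^ 2 * (P ij.1).card then ∅ else before (P ij.2) (P ij.1)
    with hBadF
  have hg : ∀ y, d (x y) (c (a y)) ≤ O := fun y => by
    rw [← hO]
    exact single_le_sum (f := fun i => d (x i) (c (a i))) (fun _ _ => hd.nonneg _ _) (mem_univ y)
  -- Markov's inequality for the distances to the assigned centers, which sum to `O`; if `O = 0`,
  -- then `Z j` is empty.
  have hZcard : ∀ j, 40 * k * ((Z j).card : ℝ) ≤ (P j).card := by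
    intro j
    rcases (Z j).eq_empty_or_nonempty with h0 | ⟨y, hy⟩
    · simp [h0]
    have hO0 : 0 < O := by
      by_contra! hneg
      have h1 : d (x y) (c (a y)) = 0 := le_antisymm ((hg y).trans hneg) (hd.nonneg _ _)
      have h2 : O = 0 := le_antisymm hneg (h1 ▸ hg y)
      have := (mem_filter.1 hy).2
      simp [h1, h2] at this
    refine le_of_mul_le_mul_right ?_ hO0
    calc 40 * k * ((Z j).card : ℝ) * O = ∑ _y ∈ Z j, 40 * k * O := by
          rw [sum_const, nsmul_eq_mul]; ring
      _ ≤ ∑ y ∈ Z j, (P j).card * d (x y) (c (a y)) :=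
        sum_le_sum fun y hy => (mem_filter.1 hy).2.le
      _ ≤ ∑ y, (P j).card * d (x y) (c (a y)) :=
        sum_le_sum_of_subset_of_nonneg (subset_univ _)
          fun _ _ _ => mul_nonneg (by positivity) (hd.nonneg _ _)
      _ = (P j).card * O := by rw [← mul_sum, hO]
  have hE : ∀ j, 40 * k * ((before (P j) (Z j)).card : ℝ) ≤ N := fun j =>
    mul_card_exists_forall_le_of_le (hZcard j)
  have hF : ∀ ij, 40 * k ^ 2 * ((BadF ij).card : ℝ) ≤ N := by
    intro ij
    simp only [hBadF]
    split_ifs with h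
    · simp [hN]
    · exact mul_card_exists_forall_le_of_le (not_le.1 h).le
  refine ⟨univ.biUnion (fun j => before (P j) (Z j)) ∪ univ.biUnion BadF, ?_, ?_⟩
  · have hE' : 40 * ((univ.biUnion (fun j => before (P j) (Z j))).card : ℝ) ≤ N := by
      refine le_of_mul_le_mul_left ?_ hk0
      calc (k : ℝ) * (40 * ((univ.biUnion (fun j => before (P j) (Z j))).card : ℝ))
          ≤ k * (40 * ∑ j, ((before (P j) (Z j)).card : ℝ)) := by
            gcongr
            exact_mod_cast card_biUnion_le
        _ = ∑ j, 40 * k * ((before (P j) (Z j)).card : ℝ) := by rw [← mul_sum]; ring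
        _ ≤ ∑ _j : Fin k, N := sum_le_sum fun j _ => hE j
        _ = k * N := by simp
    have hF' : 40 * ((univ.biUnion BadF).card : ℝ) ≤ N := by
      refine le_of_mul_le_mul_left ?_ (pow_pos hk0 2)
      calc (k : ℝ) ^ 2 * (40 * ((univ.biUnion BadF).card : ℝ))
          ≤ k ^ 2 * (40 * ∑ ij, ((BadF ij).card : ℝ)) := by
            gcongr
            exact_mod_cast card_biUnion_le
        _ = ∑ ij, 40 * k ^ 2 * ((BadF ij).card : ℝ) := by rw [← mul_sum]; ring
        _ ≤ ∑ _ij : Fin k × Fin k, N := sum_le_sum fun ij _ => hF ij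
        _ = k ^ 2 * N := by simp [sq]
    have hU : ((univ.biUnion (fun j => before (P j) (Z j)) ∪ univ.biUnion BadF).card : ℝ) ≤
        (univ.biUnion (fun j => before (P j) (Z j))).card + (univ.biUnion BadF).card := by
      exact_mod_cast card_union_le _ _
    linarith
  · intro σ hσ
    simp only [mem_union, mem_biUnion, mem_univ, true_and, not_or, not_exists] at hσ
    refine clusterCost_centersInOrder_le (K := 40 * k) (K' := 40 * k ^ 2) hd hD hk (by positivity)
      (by positivity) hO ?_ ?_ ?_
    · intro j y hy
      by_contra! hlt
      exact hσ.1 j (mem_filter.2 ⟨mem_univ _, y, mem_filter.2 ⟨mem_univ _, hlt⟩, hy⟩)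
    · intro i j hij
      by_contra hlt
      refine hσ.2 (i, j) ?_
      rw [hBadF]
      simp only [P] at hlt ⊢
      rw [if_neg hlt]
      exact mem_filter.2 ⟨mem_univ _, hij⟩
    · have h1 : (1 : ℝ) ≤ D ^ 3 := one_le_pow₀ hD
      have h2 : (1 : ℝ) ≤ 4 * (40 * k) + 40 * k ^ 2 := by nlinarith
      nlinarith

/-- Since `D`, `k * D ^ 2`, `40 * k` and `3` are all at most `β`, the factor is at most `β ^ (k + 2)
≤ β ^ (3 * k)`, and `log β` is at most a constant depending on `D` times `log (k + 1)`. -/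
theorem approxFactor_le_exp (hD : 1 ≤ D) (hk : 1 ≤ k) :
    approxFactor D k ≤ Real.exp (3 * (Real.log (200 * D ^ 3) / Real.log 2 + 2) *
      (k * Real.log ((k : ℝ) + 1))) := by
  have hk0 : (0 : ℝ) < k := by exact_mod_cast hk
  have hk1 : (1 : ℝ) ≤ k := by exact_mod_cast hk
  have hD0 : 0 < D := by linarith
  have hD2 : (1 : ℝ) ≤ D ^ 2 := one_le_pow₀ hD
  have hD3 : (1 : ℝ) ≤ D ^ 3 := one_le_pow₀ hD
  have hD23 : D ^ 2 ≤ D ^ 3 := pow_le_pow_right₀ hD (by norm_num)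
  have hl2 : 0 < Real.log 2 := Real.log_pos (by norm_num)
  rw [approxFactor]
  set β := D ^ 3 * (4 * (40 * k) + 40 * k ^ 2) with hβ
  have hsum : 160 * (k : ℝ) ≤ 4 * (40 * k) + 40 * k ^ 2 := by nlinarith
  have hβ160 : D ^ 3 * (160 * k) ≤ β :=
    mul_le_mul_of_nonneg_left hsum (by positivity)
  have hkβ : (k : ℝ) * D ^ 2 ≤ β := by nlinarith
  have hKβ : 40 * (k : ℝ) ≤ β := by nlinarith
  have hβ3 : 3 ≤ β := by linarith
  have hDβ : D ≤ β := by nlinarith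
  have hβ1 : 1 ≤ β := by linarith
  have hle : β ≤ 200 * D ^ 3 * (k + 1) ^ 2 := by
    have : 4 * (40 * (k : ℝ)) + 40 * k ^ 2 ≤ 200 * (k + 1) ^ 2 := by nlinarith
    calc β ≤ D ^ 3 * (200 * (k + 1) ^ 2) := by rw [hβ]; gcongr
      _ = _ := by ring
  have hlog : Real.log β ≤ (Real.log (200 * D ^ 3) / Real.log 2 + 2) * Real.log (k + 1) := by
    have h1 : Real.log 2 ≤ Real.log (k + 1) := Real.log_le_log (by norm_num) (by linarith)
    have h2 : 0 ≤ Real.log (200 * D ^ 3) := Real.log_nonneg (by linarith)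
    calc Real.log β ≤ Real.log (200 * D ^ 3 * (k + 1) ^ 2) :=
          Real.log_le_log (by linarith) hle
      _ = Real.log (200 * D ^ 3) / Real.log 2 * Real.log 2 + 2 * Real.log (k + 1) := by
        rw [Real.log_mul (by positivity) (by positivity), Real.log_pow]
        field_simp
        push_cast
        ring
      _ ≤ Real.log (200 * D ^ 3) / Real.log 2 * Real.log (k + 1) + 2 * Real.log (k + 1) := by
        gcongr
      _ = _ := by ring
  calc D + k * (D ^ 2 * (40 * k + β ^ k))
      = D + k * D ^ 2 * (40 * k) + k * D ^ 2 * β ^ k := by ring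
    _ ≤ β + β * β + β * β ^ k := by gcongr
    _ = β ^ 1 + β ^ 2 + β ^ (k + 1) := by ring
    _ ≤ β ^ (k + 1) + β ^ (k + 1) + β ^ (k + 1) := by
      gcongr <;> first | exact hβ1 | omega
    _ = 3 * β ^ (k + 1) := by ring
    _ ≤ β * β ^ (k + 1) := by gcongr
    _ = β ^ (k + 2) := by ring
    _ ≤ β ^ (3 * k) := pow_le_pow_right₀ hβ1 (by omega)
    _ = Real.exp (3 * k * Real.log β) := by
      rw [← Real.exp_log (show 0 < β by linarith), ← Real.exp_nat_mul, Real.log_exp]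
      push_cast
      rfl
    _ ≤ Real.exp (3 * k * ((Real.log (200 * D ^ 3) / Real.log 2 + 2) * Real.log (k + 1))) := by
      gcongr
    _ = _ := by congr 1; ring

/-- Some choice of `k` centers is so close to optimal that no order of arrival can tell its cost
from the optimal cost. -/
theorem exists_nearly_optimal {ι : Type*} [Finite ι] (d : X → X → ℝ) (k : ℕ) (V : ι → ℝ) {G : ℝ}
    (hG : 0 < G) :
    ∃ c : Fin k → X, ∀ i, V i ≤ G * clusterCost d x c → V i ≤ G * optCost d x k := by
  have : Nonempty (Fin k → X) := ⟨fun _ => x 0⟩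
  -- Each `i` violating the bound at the optimum is ruled out once `y < V i / G`; finitely many such
  -- conditions hold together just above the optimum.
  have h : ∀ᶠ y in nhdsWithin (optCost d x k) (Set.Ioi (optCost d x k)),
      ∀ i, V i ≤ G * y → V i ≤ G * optCost d x k := by
    refine Filter.eventually_all.2 fun i => ?_
    by_cases hi : V i ≤ G * optCost d x k
    · exact Filter.Eventually.of_forall fun _ _ => hi
    · have h1 : optCost d x k < V i / G := by
        rw [lt_div_iff₀ hG, mul_comm]
        exact not_le.1 hi
      filter_upwards [mem_nhdsWithin_of_mem_nhds (Iio_mem_nhds h1)] with y hy hV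
      rw [Set.mem_Iio, lt_div_iff₀ hG, mul_comm] at hy
      exact absurd hV (not_le.2 hy)
  obtain ⟨y, hy, hlt⟩ := (h.and self_mem_nhdsWithin).exists
  obtain ⟨c, hc⟩ := exists_lt_of_ciInf_lt (show ⨅ c : Fin k → X, clusterCost d x c < y from hlt)
  exact ⟨c, fun i hi => hy i (hi.trans (by gcongr))⟩

end Main

theorem mainTheorem2 :
    ∃ C : ℝ, 0 < C ∧ ∃ B : ℕ → ℝ, ∀ D : ℝ, 1 ≤ D → ∃ A : ℝ, 0 < A ∧
      ∀ k : ℕ, 1 ≤ k → ∀ (X : Type u) (d : X → X → ℝ), IsDDistance d D →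
      ∀ n : ℕ, 1 ≤ n → ∀ (x : Fin n → X) (tie : TieRule (Fin n)),
        9 / 10 ≤ randomOrderProb n fun σ =>
          (2 * k ≤ n →
            ((centersInOrder d x tie k σ).card : ℝ) ≤ C * (k * Real.log ((n : ℝ) / (k : ℝ)))) ∧
          (2 ≤ n →
            ((centersInOrder d x tie k σ).card : ℝ) ≤ B k * Real.log n) ∧
          clusterCost d x (fun c : ↥(centersInOrder d x tie k σ) => x c) ≤
            Real.exp (A * (k * Real.log ((k : ℝ) + 1))) * optCost d x k := by
  have hl2 : 0 < Real.log 2 := Real.log_pos (by norm_num)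
  refine ⟨20 * (2 / Real.log 2 + 1), by positivity,
    fun k => 20 * (2 / Real.log 2 + 1) * k + 2 * k / Real.log 2, fun D hD =>
    ⟨3 * (Real.log (200 * D ^ 3) / Real.log 2 + 2), ?_, ?_⟩⟩
  · have h1 : (1 : ℝ) ≤ D ^ 3 := one_le_pow₀ hD
    have h2 : 0 ≤ Real.log (200 * D ^ 3) := Real.log_nonneg (by linarith)
    positivity
  intro k hk X d hd n hn x tie
  have : NeZero n := ⟨by omega⟩
  set G := Real.exp (3 * (Real.log (200 * D ^ 3) / Real.log 2 + 2) *
    (k * Real.log ((k : ℝ) + 1)))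
  have hk0 : Nonempty (Fin k) := ⟨⟨0, hk⟩⟩
  obtain ⟨c, hc⟩ := exists_nearly_optimal x d k (fun σ : Equiv.Perm (Fin n) =>
    clusterCost d x (fun q : ↥(centersInOrder d x tie k σ) => x q)) (Real.exp_pos _ : 0 < G)
  obtain ⟨Bad₁, hBad₁, h₁⟩ := exists_few_exceptions_card x tie d hk
  obtain ⟨Bad₂, hBad₂, h₂⟩ := exists_few_exceptions_cost x tie hd hD hk c
  refine nine_tenths_le_randomOrderProb Bad₁ Bad₂ hBad₁ hBad₂ fun σ hσ₁ hσ₂ =>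
    ⟨(h₁ σ hσ₁).1, (h₁ σ hσ₁).2, hc σ ((h₂ σ hσ₂).trans ?_)⟩
  refine mul_le_mul_of_nonneg_right (approxFactor_le_exp hD hk) ?_
  exact sum_nonneg fun i _ => le_ciInf fun j => hd.nonneg _ _
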